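/- Let $\Phi$ be a finite reduced crystallographic root system spanning a finite dimensional real vector space $V$, with Weyl group $W\subseteq GL(V)$, simple roots $\alpha_1,\dots,\alpha_n$, simple coroots $\alpha_1^\vee,\dots,\alpha_n^\vee$, chamber $C=\{x\in V:\langle x,\alpha_i^\vee\rangle>0\text{ for all }i\}$, weight lattice $P=\{\lambda\in V:\langle\lambda,\alpha^\vee\rangle\in\mathbb Z\text{ for all }\alpha\in\Phi\}$, fundamental weights $\omega_1,\dots,\omega_n$ (the basis of $V$ dual to the simple coroots) and $\rho=\omega_1+\dots+\omega_n$. Let $\mathbb Z[P]$ be the group algebra of $P$, with basis $X^\lambda$, $\lambda\in P$. For $\mu\in P$ put $a_\mu=\sum_{w\in W}\det(w)X^{w\mu}$, and let $s_\mu=a_{\mu+\rho}/a_\rho$ (a quotient in the field of fractions of $\mathbb Z[P]$) be the Weyl character. *Paths.* Consider maps $p:[0,\ell]\to V$ with $\ell\ge 0$, and let $\mathrm{wt}(p)=p(\ell)$. A *path* is a map obtained from the straight line maps $[0,1]\to V$, $t\mapsto t\lambda$ ($\lambda\in P$), by repeatedly using: concatenation, $(p\otimes q)(t)=p(t)$ on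 $[0,\ell_1]$ and $p(\ell_1)+q(t-\ell_1)$ on $[\ell_1,\ell_1+\ell_2]$; reversal, $p^*(t)=p(\ell-t)-p(\ell)$; and stretching by a real $r\ge 0$, $(rp)(t)=r\,p(t/r)$ on $[0,r\ell]$ (for $r=0$: the map $[0,0]\to V$ with value $0$). *Root operators.* For $h:[0,\ell]\to\mathbb R$ continuous with minimum $m$ put $$(\tilde f h)(t)=h(t)-2\min\bigl(1,\ \min_{s\ge t}h(s)-m\bigr)\ \text{ if } h(\ell)-m\ge 1,\qquad \tilde f h=0\ \text{ otherwise},$$ $$(\tilde e h)(t)=h(t)+2-2\min\bigl(1,\ \min_{s\le t}h(s)-m\bigr)\ \text{ if } h(0)-m\ge 1,\qquad \tilde e h=0\ \text{ otherwise},$$ where $0$ is a symbol that is not a map. For a path $p$ let $p_i(t)=\langle p(t),\alpha_i^\vee\rangle$, and let $$\tilde f_i p=p-\tfrac12(p_i-\tilde f p_i)\,\alpha_i,\qquad \tilde e_i p=p+\tfrac12(\tilde e p_i-p_i)\,\alpha_i,$$ understood as $0$ when $\tilde f p_i=0$, respectively $\tilde e p_i=0$. A *crystal* is a set $B$ of paths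 such that for all $p\in B$ and $1\le i\le n$ each of $\tilde e_ip$, $\tilde f_ip$ is $0$ or lies in $B$. A *highest weight path* is a path $p$ with $\tilde e_ip=0$ for all $i$. **Theorem.** Let $B$ be a finite crystal with $\mathrm{wt}(p)\in P$ for all $p\in B$, so that $\mathrm{char}(B)=\sum_{p\in B}X^{\mathrm{wt}(p)}$ is an element of $\mathbb Z[P]$. Then a path $p\in B$ is a highest weight path if and only if its image is contained in $C-\rho=\{\mu-\rho:\mu\in C\}$, and $$\mathrm{char}(B)=\sum_{p\in B,\ p\subseteq C-\rho}s_{\mathrm{wt}(p)}.$$ -/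

import Mathlib

open scoped Classical

noncomputable section

namespace PathModel

/-! ### Maps `p : [0, ℓ] → V` -/

/-- A map `p : [0, ℓ] → V`, where `ℓ ≥ 0` is part of the data. -/
structure PathMap (V : Type*) where
  len : ℝ
  len_nonneg : 0 ≤ len
  toFun : Set.Icc (0 : ℝ) len → V

namespace PathMap

variable {V : Type*} [AddCommGroup V] [Module ℝ V]

/-- The weight of `p : [0, ℓ] → V` is its endpoint `p(ℓ)`. -/
def wt (p : PathMap V) : V :=
  p.toFun ⟨p.len, p.len_nonneg, le_rfl⟩

/-- The straight line path `t ↦ t • v`, for `t ∈ [0, 1]`. -/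
def straight (v : V) : PathMap V where
  len := 1
  len_nonneg := zero_le_one
  toFun t := (t : ℝ) • v

/-- The concatenation `p ⊗ q : [0, ℓ₁ + ℓ₂] → V`. -/
def concat (p q : PathMap V) : PathMap V where
  len := p.len + q.len
  len_nonneg := add_nonneg p.len_nonneg q.len_nonneg
  toFun t :=
    if h : (t : ℝ) ≤ p.len then p.toFun ⟨t, t.2.1, h⟩
    else p.wt + q.toFun ⟨t - p.len, sub_nonneg.2 (not_le.1 h).le, sub_le_iff_le_add'.2 t.2.2⟩

/-- The `r`-stretch `t ↦ r • p(t / r)`, for `t ∈ [0, r ℓ]`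
(for `r = 0` this is the map `[0, 0] → V` with value `0`). -/
def stretch (r : ℝ) (hr : 0 ≤ r) (p : PathMap V) : PathMap V where
  len := r * p.len
  len_nonneg := mul_nonneg hr p.len_nonneg
  toFun t := r • p.toFun ⟨t / r, div_nonneg t.2.1 hr,
    div_le_of_le_mul₀ hr p.len_nonneg (t.2.2.trans_eq (mul_comm _ _))⟩

/-- The reverse `t ↦ p(ℓ - t) - p(ℓ)`. -/
def reverse (p : PathMap V) : PathMap V where
  len := p.len
  len_nonneg := p.len_nonneg
  toFun t := p.toFun ⟨p.len - t, sub_nonneg.2 t.2.2, sub_le_self _ t.2.1⟩ - p.wt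

end PathMap

/-! ### Root operators in rank one

For `h : [0, ℓ] → ℝ` let `m` be its minimum. For a word in the letters `+1, -1, 0`, viewed as the
path with these unit steps, a step `+1` (resp. `-1`) is unpaired in the bracketing of `(+1, -1)`
pairs exactly when the future minimum `t ↦ min_{s ≥ t} h(s)` increases (resp. the past minimum
`t ↦ min_{s ≤ t} h(s)` decreases) along it. So `h(ℓ) - m` is the number of unpaired `+1`s,
`h(0) - m` is the number of unpaired `-1`s, changing the leftmost unpaired `+1` to `-1` subtracts
`2 min(1, min_{s ≥ t} h(s) - m)` from `h(t)`, and changing the rightmost unpaired `-1` to `+1` adds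
`2 (1 - min(1, min_{s ≤ t} h(s) - m))` to `h(t)`. These formulas commute with stretching (they give
`f^r (r h) = r (f h)` and `e^r (r h) = r (e h)`), and they define the operators on all paths.
The value `none` is the `0` of crystal theory. -/

section RankOne

variable {ℓ : ℝ}

/-- The rank one operator `f`. -/
def rankOneF (hℓ : 0 ≤ ℓ) (h : Set.Icc (0 : ℝ) ℓ → ℝ) : Option (Set.Icc (0 : ℝ) ℓ → ℝ) :=
  if 1 ≤ h ⟨ℓ, hℓ, le_rfl⟩ - ⨅ s, h s then
    some fun t => h t - 2 * min 1 ((⨅ s : Set.Ici t, h s) - ⨅ s, h s)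
  else none

/-- The rank one operator `e`. -/
def rankOneE (hℓ : 0 ≤ ℓ) (h : Set.Icc (0 : ℝ) ℓ → ℝ) : Option (Set.Icc (0 : ℝ) ℓ → ℝ) :=
  if 1 ≤ h ⟨0, le_rfl, hℓ⟩ - ⨅ s, h s then
    some fun t => h t + 2 * (1 - min 1 ((⨅ s : Set.Iic t, h s) - ⨅ s, h s))
  else none

end RankOne

/-! ### The weight lattice, paths, root operators, crystals -/

variable {ι V N : Type*} [AddCommGroup V] [Module ℝ V] [AddCommGroup N] [Module ℝ N]

section Paths

variable (Φ : RootPairing ι ℝ V N)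

/-- The weight lattice `P = {λ ∈ V | ⟨λ, α^∨⟩ ∈ ℤ for all roots α}`. -/
def weightLattice : AddSubgroup V where
  carrier := {x | ∀ i, ∃ k : ℤ, Φ.coroot' i x = k}
  zero_mem' i := ⟨0, by simp⟩
  add_mem' {x y} hx hy i := by
    obtain ⟨k, hk⟩ := hx i
    obtain ⟨l, hl⟩ := hy i
    exact ⟨k + l, by rw [map_add, hk, hl]; push_cast; rfl⟩
  neg_mem' {x} hx i := by
    obtain ⟨k, hk⟩ := hx i
    exact ⟨-k, by rw [map_neg, hk]; push_cast; rfl⟩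

/-- The set `B_univ` of paths: the maps generated by the straight line paths to weights `λ ∈ P`
under concatenation, reversing and stretching. -/
inductive IsPath : PathMap V → Prop
  | straight (v : V) (hv : v ∈ weightLattice Φ) : IsPath (PathMap.straight v)
  | concat (p q : PathMap V) (hp : IsPath p) (hq : IsPath q) : IsPath (p.concat q)
  | reverse (p : PathMap V) (hp : IsPath p) : IsPath p.reverse
  | stretch (r : ℝ) (hr : 0 ≤ r) (p : PathMap V) (hp : IsPath p) : IsPath (p.stretch r hr)

/-- The projection `p_α(t) = ⟨p(t), α^∨⟩`. -/
def proj (i : ι) (p : PathMap V) (t : Set.Icc (0 : ℝ) p.len) : ℝ :=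
  Φ.coroot' i (p.toFun t)

/-- The root operator `f_α p = p - ½ (p_α - f p_α) α`. -/
def rootF (i : ι) (p : PathMap V) : Option (PathMap V) :=
  (rankOneF p.len_nonneg (proj Φ i p)).map fun h =>
    { p with toFun := fun t => p.toFun t - ((1 / 2 : ℝ) * (proj Φ i p t - h t)) • Φ.root i }

/-- The root operator `e_α p = p + ½ (e p_α - p_α) α`. -/
def rootE (i : ι) (p : PathMap V) : Option (PathMap V) :=
  (rankOneE p.len_nonneg (proj Φ i p)).map fun h =>
    { p with toFun := fun t => p.toFun t + ((1 / 2 : ℝ) * (h t - proj Φ i p t)) • Φ.root i }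

variable {Φ}

/-- A crystal: a set of paths closed under the root operators of the simple roots. -/
structure IsCrystal (b : Φ.Base) (B : Set (PathMap V)) : Prop where
  isPath : ∀ p ∈ B, IsPath Φ p
  rootE_mem : ∀ i ∈ b.support, ∀ p ∈ B, ∀ q, rootE Φ i p = some q → q ∈ B
  rootF_mem : ∀ i ∈ b.support, ∀ p ∈ B, ∀ q, rootF Φ i p = some q → q ∈ B

/-- A highest weight path: `e_i p = 0` for all simple roots `α_i`. -/
def IsHighestWeight (b : Φ.Base) (p : PathMap V) : Prop :=
  ∀ i ∈ b.support, rootE Φ i p = none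

end Paths

/-! ### The Weyl group, the vector `ρ`, the chamber -/

section Weyl

variable (Φ : RootPairing ι ℝ V N)

/-- The Weyl group of a finite root system is finite. -/
instance finite_weylGroup [Finite ι] [Φ.IsRootSystem] : Finite Φ.weylGroup := by
  refine Finite.of_injective (fun w : Φ.weylGroup => Φ.weylGroupToPerm w) fun w w' h => ?_
  apply Subtype.ext
  apply RootPairing.Equiv.weightHom_injective Φ
  apply LinearEquiv.toLinearMap_injective
  apply LinearMap.ext_on_range (v := Φ.root) RootPairing.IsRootSystem.span_root_eq_top
  intro i
  have h1 := Φ.weylGroup_apply_root w i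
  have h2 := Φ.weylGroup_apply_root w' i
  simp only at h
  rw [h, ← h2] at h1
  exact h1

instance fintype_weylGroup [Finite ι] [Φ.IsRootSystem] : Fintype Φ.weylGroup :=
  Fintype.ofFinite _

/-- The determinant of `w` on `V`; it is `±1` (see `weylDet_cast`), and is given as the integer
with the same sign. -/
def weylDet (w : Φ.weylGroup) : ℤ :=
  (SignType.sign (LinearMap.det
    (RootPairing.Equiv.weightHom Φ (w : Φ.Aut) : V →ₗ[ℝ] V)) : ℤ)

theorem weylDet_cast (w : Φ.weylGroup) :
    (weylDet Φ w : ℝ) =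
      LinearMap.det (RootPairing.Equiv.weightHom Φ (w : Φ.Aut) : V →ₗ[ℝ] V) := by
  have key : LinearMap.det (RootPairing.Equiv.weightHom Φ (w : Φ.Aut) : V →ₗ[ℝ] V) = 1 ∨
      LinearMap.det (RootPairing.Equiv.weightHom Φ (w : Φ.Aut) : V →ₗ[ℝ] V) = -1 := by
    obtain ⟨w, hw⟩ := w
    induction hw using RootPairing.weylGroup.induction with
    | mem i =>
      have h : RootPairing.Equiv.reflection Φ i * RootPairing.Equiv.reflection Φ i = 1 := by
        rw [mul_eq_one_iff_inv_eq, RootPairing.Equiv.reflection_inv Φ i]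
      have h2 := congrArg (fun u => LinearMap.det
        (RootPairing.Equiv.weightHom Φ u : V →ₗ[ℝ] V)) h
      simp only [map_mul, map_one] at h2
      rw [LinearEquiv.coe_toLinearMap_mul, map_mul, LinearEquiv.coe_toLinearMap_one] at h2
      simp only [LinearMap.det_id] at h2
      exact mul_self_eq_one_iff.1 h2
    | one =>
      left
      simp only [map_one]
      exact LinearMap.det_id
    | mul x y hx hy hx' hy' =>
      simp only [map_mul, LinearEquiv.coe_toLinearMap_mul] at hx' hy' ⊢
      rcases hx' with h | h <;> rcases hy' with h' | h' <;> rw [h, h'] <;> simp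
  unfold weylDet
  rcases key with h | h <;> rw [h] <;> simp

theorem weyl_smul_mem (w : Φ.weylGroup) {x : V} (hx : x ∈ weightLattice Φ) :
    w • x ∈ weightLattice Φ := by
  obtain ⟨w, hw⟩ := w
  induction hw using RootPairing.weylGroup.induction generalizing x with
  | mem i =>
    intro j
    obtain ⟨k, hk⟩ := hx (Φ.reflectionPerm i j)
    refine ⟨k, ?_⟩
    rw [← hk]
    change Φ.coroot' j (Φ.reflection i x) = _
    simp only [LinearMap.flip_apply, ← Φ.reflectionPerm_coroot, Φ.reflection_apply]
    simp [mul_comm]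
  | one => simpa using! hx
  | mul u v hu hv hu' hv' => exact hu' (hv' hx)

/-- The action of the Weyl group on the weight lattice. -/
def weylAct (w : Φ.weylGroup) (μ : weightLattice Φ) : weightLattice Φ :=
  ⟨w • (μ : V), weyl_smul_mem Φ w μ.2⟩

variable {Φ}
variable [Φ.IsRootSystem] (b : Φ.Base)

/-- The fundamental weights: the basis of `V` dual to the simple coroots. -/
def fundamentalWeight (i : b.support) : V :=
  Φ.toLinearMap.toPerfPair.symm (b.toCoweightBasis.coord i)

theorem coroot_fundamentalWeight (i j : b.support) :
    Φ.coroot' j (fundamentalWeight b i) = if i = j then 1 else 0 := by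
  change Φ.toLinearMap (fundamentalWeight b i) (Φ.coroot j) = _
  rw [fundamentalWeight, LinearMap.apply_symm_toPerfPair_self, Module.Basis.coord_apply,
    RootPairing.Base.toCoweightBasis_repr_coroot, Finsupp.single_apply]
  simp only [eq_comm]

theorem fundamentalWeight_mem (i : b.support) : fundamentalWeight b i ∈ weightLattice Φ := by
  intro j
  have key : ∀ y ∈ Submodule.span ℤ (Φ.coroot '' b.support),
      ∃ k : ℤ, Φ.toLinearMap (fundamentalWeight b i) y = k := by
    intro y hy
    induction hy using Submodule.span_induction with
    | mem y hy =>
      obtain ⟨l, hl, rfl⟩ := hy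
      have h := coroot_fundamentalWeight b i ⟨l, hl⟩
      refine ⟨if i = ⟨l, hl⟩ then 1 else 0, ?_⟩
      push_cast
      exact h
    | zero => exact ⟨0, by simp⟩
    | add y z _ _ hy hz =>
      obtain ⟨k, hk⟩ := hy
      obtain ⟨l, hl⟩ := hz
      exact ⟨k + l, by rw [map_add, hk, hl]; push_cast; rfl⟩
    | smul a y _ hy =>
      obtain ⟨k, hk⟩ := hy
      exact ⟨a * k, by rw [map_zsmul, hk, zsmul_eq_mul]; push_cast; rfl⟩
  exact key _ (b.coroot_mem_span_int j)

/-- `ρ` is the sum of the fundamental weights. -/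
def rho : weightLattice Φ :=
  ∑ i : b.support, ⟨fundamentalWeight b i, fundamentalWeight_mem b i⟩

/-- The chamber `C = {x | ⟨x, α_i^∨⟩ > 0 for all simple roots α_i}`. -/
def chamber {Φ : RootPairing ι ℝ V N} (b : Φ.Base) : Set V :=
  {x | ∀ i ∈ b.support, 0 < Φ.coroot' i x}

/-- The region `C - ρ`, where `C` is the chamber of the base. -/
def shiftedChamber : Set V :=
  (fun μ => μ - (rho b : V)) '' chamber b

end Weyl

/-! ### The group algebra `ℤ[P]`, characters, Weyl characters -/

section Characters

variable (Φ : RootPairing ι ℝ V N)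

instance uniqueSums_weightLattice : UniqueSums (weightLattice Φ) :=
  letI : Module ℚ V := Module.compHom V (algebraMap ℚ ℝ)
  UniqueSums.of_injective_addHom (weightLattice Φ).subtype.toAddHom
    Subtype.val_injective inferInstance

/-- The group algebra `ℤ[P]` of the weight lattice. -/
abbrev GroupAlg : Type _ := AddMonoidAlgebra ℤ (weightLattice Φ)

variable {Φ}

/-- The basis element `X^μ` of `ℤ[P]`. -/
def X (μ : weightLattice Φ) : GroupAlg Φ := AddMonoidAlgebra.single μ 1

/-- The character `char(B) = ∑_{p ∈ B} X^{wt(p)}` of a finite set of paths whose weights lie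
in `P`. -/
def char (B : Finset (PathMap V)) (hwt : ∀ p ∈ B, p.wt ∈ weightLattice Φ) : GroupAlg Φ :=
  ∑ p : B, X ⟨p.1.wt, hwt p.1 p.2⟩

variable [Finite ι] [Φ.IsRootSystem]

/-- `a_μ = ∑_{w ∈ W} det(w) X^{wμ}`. -/
def alternant (μ : weightLattice Φ) : GroupAlg Φ :=
  ∑ w : Φ.weylGroup, weylDet Φ w • X (weylAct Φ w μ)

/-- The Weyl character `s_μ = a_{μ+ρ} / a_ρ`, a quotient of elements of the domain `ℤ[P]`. -/
def weylChar (b : Φ.Base) (μ : weightLattice Φ) : FractionRing (GroupAlg Φ) :=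
  algebraMap (GroupAlg Φ) (FractionRing (GroupAlg Φ)) (alternant (μ + rho b)) /
    algebraMap (GroupAlg Φ) (FractionRing (GroupAlg Φ)) (alternant (rho b))

end Characters

end PathModel

end

/-! The character formula, multiplied by $a_\rho$, reads $a_\rho\,\mathrm{char}(B)=\sum
a_{\mathrm{wt}(p)+\rho}$ over the paths inside $C-\rho$. Two involutions on strings prove it. Each
simple root cuts $B$ into finite strings (`IsCrystal.isStringSystem`), because `f` and `e` are
mutually inverse and move the minimum of $p_i$ by exactly one. Reversing every $i$-string applies
$s_i$ to weights, so $\mathrm{char}(B)$ is $W$-invariant (`IsCrystal.map_weylAct`). An action of $W$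
on $B$ is not needed: generators suffice to compare multisets of weights. Invariance turns
$a_\rho\,\mathrm{char}(B)$ into $\sum a_{\mathrm{wt}(p)+\rho}$ over all of $B$
(`alternant_mul_sum`). The paths leaving $C-\rho$ then cancel (`IsCrystal.sum_alternant_eq_zero`).
For such a path, take a wall $i$ met at the first exit time and reverse its $i$-string with the top
element removed. This applies $s_i$ to $\mathrm{wt}(p)+\rho$ and so negates the alternant. It does
not alter the path up to the exit time (`IsCrystal.agreeUpTo_shift`), so the same wall is chosen
again and the map is an involution. Finally $a_\rho\ne0$ (`alternant_rho_ne_zero`). The highest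
weight criterion is immediate: since $p_i(0)=0$, both conditions say that no $p_i$ reaches $-1$. -/

noncomputable section

namespace PathModel

set_option linter.unusedSectionVars false

/-! ### Rank one operators on a compact connected linear order. -/

section RankOneGeneral

variable {T : Type*} [LinearOrder T] [TopologicalSpace T] [OrderClosedTopology T] [CompactSpace T]

/-- The operator `f` on functions on a linear order, without its domain of definition. -/
def lowerFun (h : T → ℝ) (t : T) : ℝ :=
  h t - 2 * min 1 ((⨅ s : Set.Ici t, h s) - ⨅ s, h s)

/-- The operator `e` on functions on a linear order, without its domain of definition. -/
def raiseFun (h : T → ℝ) (t : T) : ℝ :=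
  h t + 2 * (1 - min 1 ((⨅ s : Set.Iic t, h s) - ⨅ s, h s))

theorem bddBelow_range_of_compact {h : T → ℝ} (hc : Continuous h) :
    BddBelow (Set.range h) :=
  (isCompact_range hc).bddBelow

theorem ciInf_le_of_compact {h : T → ℝ} (hc : Continuous h) (t : T) : ⨅ s, h s ≤ h t :=
  ciInf_le (bddBelow_range_of_compact hc) t

theorem exists_eq_ciInf_of_compact [Nonempty T] {h : T → ℝ} (hc : Continuous h) :
    ∃ t, h t = ⨅ s, h s := by
  obtain ⟨t, -, ht⟩ := isCompact_univ.exists_isMinOn Set.univ_nonempty hc.continuousOn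
  exact ⟨t, le_antisymm (le_ciInf fun s => ht (Set.mem_univ s)) (ciInf_le_of_compact hc t)⟩

theorem futureMin_le {h : T → ℝ} (hc : Continuous h) {t s : T} (hs : t ≤ s) :
    ⨅ u : Set.Ici t, h u ≤ h s :=
  ciInf_le ((bddBelow_range_of_compact hc).mono (by rintro _ ⟨u, rfl⟩; exact ⟨u, rfl⟩))
    (⟨s, hs⟩ : Set.Ici t)

theorem le_futureMin {h : T → ℝ} {t : T} {c : ℝ} (H : ∀ s, t ≤ s → c ≤ h s) :
    c ≤ ⨅ u : Set.Ici t, h u :=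
  have : Nonempty (Set.Ici t) := ⟨⟨t, le_rfl⟩⟩
  le_ciInf fun u => H u u.2

theorem ciInf_le_futureMin {h : T → ℝ} (hc : Continuous h) (t : T) :
    ⨅ u, h u ≤ ⨅ u : Set.Ici t, h u :=
  le_futureMin fun s _ => ciInf_le_of_compact hc s

theorem futureMin_mono {h : T → ℝ} (hc : Continuous h) {s t : T} (hst : s ≤ t) :
    ⨅ u : Set.Ici s, h u ≤ ⨅ u : Set.Ici t, h u :=
  le_futureMin fun _ hu => futureMin_le hc (hst.trans hu)

/-- A level `c` between the minimum of `h` and its future minimum at `t` is the value, and the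
future minimum, of `h` at some time before `t`. -/
theorem exists_last_crossing [PreconnectedSpace T] {h : T → ℝ} (hc : Continuous h) {t : T} {c : ℝ}
    (h1 : ∃ u ≤ t, h u ≤ c) (h2 : c ≤ ⨅ u : Set.Ici t, h u) :
    ∃ s ≤ t, h s = c ∧ ⨅ u : Set.Ici s, h u = c := by
  have hcl : IsClosed {u | u ≤ t ∧ h u ≤ c} :=
    isClosed_Iic.inter (isClosed_le hc continuous_const)
  obtain ⟨s, ⟨hst, hsc⟩, hmax⟩ := hcl.isCompact.exists_isGreatest h1
  have hlater : ∀ u, s < u → c ≤ h u := by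
    intro u hu
    rcases le_or_gt u t with hut | hut
    · by_contra hlt
      exact absurd (hmax ⟨hut, (not_le.1 hlt).le⟩) (not_le.2 hu)
    · exact h2.trans (futureMin_le hc hut.le)
  have hs : h s = c := by
    by_contra hne
    have hlt : h s < c := lt_of_le_of_ne hsc hne
    have hslt : s < t := lt_of_le_of_ne hst (by
      rintro rfl
      exact absurd (h2.trans (futureMin_le hc le_rfl)) (not_le.2 hlt))
    -- If `h s < c`, maximality of `s` leaves a gap just after `s`, so this closed initial segment
    -- is also open, against connectedness.
    have hopen : IsOpen (Set.Iic s) := by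
      have : Set.Iic s = Set.Iio s ∪ (Set.Iio t ∩ {u | h u < c}) := by
        ext u
        constructor
        · intro hu
          rcases lt_or_eq_of_le (Set.mem_Iic.1 hu) with hu | rfl
          · exact Or.inl hu
          · exact Or.inr ⟨hslt, hlt⟩
        · rintro (hu | ⟨hu, hu'⟩)
          · exact (Set.mem_Iio.1 hu).le
          · exact hmax ⟨(Set.mem_Iio.1 hu).le, le_of_lt hu'⟩
      rw [this]
      exact isOpen_Iio.union (isOpen_Iio.inter (isOpen_lt hc continuous_const))
    have huniv := IsClopen.eq_univ ⟨isClosed_Iic, hopen⟩ ⟨s, Set.mem_Iic.2 le_rfl⟩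
    exact absurd (Set.mem_Iic.1 (huniv ▸ Set.mem_univ t : t ∈ Set.Iic s)) (not_le.2 hslt)
  refine ⟨s, hst, hs, le_antisymm (hs ▸ futureMin_le hc le_rfl) (le_futureMin fun u hu => ?_)⟩
  rcases eq_or_lt_of_le hu with rfl | hu
  · exact hs.ge
  · exact hlater u hu

theorem le_lowerFun {h : T → ℝ} (hc : Continuous h) {c : ℝ} (hc1 : c ≤ 1) {t : T}
    (ht : (⨅ u : Set.Ici t, h u) - (⨅ u, h u) ≤ c) : (⨅ u, h u) - c ≤ lowerFun h t := by
  have h1 := futureMin_le hc (le_refl t)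
  unfold lowerFun
  rw [min_eq_right (ht.trans hc1)]
  linarith

theorem ciInf_sub_one_le_lowerFun {h : T → ℝ} (hc : Continuous h) (t : T) :
    (⨅ u, h u) - 1 ≤ lowerFun h t := by
  rcases le_total ((⨅ u : Set.Ici t, h u) - (⨅ u, h u)) 1 with h1 | h1
  · exact le_lowerFun hc le_rfl h1
  · have := futureMin_le hc (le_refl t)
    unfold lowerFun
    rw [min_eq_left h1]
    linarith

variable [PreconnectedSpace T]

/-- At the last crossing of level $m+c$ both `h` and its future minimum equal $m+c$, so `lowerFun`
takes the value $m+c-2c$ there. Positivity of `c` forces the minimum to be attained before `t`. -/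
theorem exists_lowerFun_eq [Nonempty T] {h : T → ℝ} (hc : Continuous h) {t : T} {c : ℝ}
    (hc0 : 0 < c) (hc1 : c ≤ 1) (ht : c ≤ (⨅ u : Set.Ici t, h u) - ⨅ u, h u) :
    ∃ s ≤ t, lowerFun h s = (⨅ u, h u) - c := by
  obtain ⟨v, hv⟩ := exists_eq_ciInf_of_compact hc
  have hvt : v ≤ t := by
    by_contra hlt
    have := futureMin_le hc (not_le.1 hlt).le
    linarith
  obtain ⟨s, hst, hs, hs'⟩ := exists_last_crossing hc (t := t) (c := (⨅ u, h u) + c)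
    ⟨v, hvt, by linarith⟩ (by linarith)
  refine ⟨s, hst, ?_⟩
  unfold lowerFun
  rw [hs', hs, add_sub_cancel_left, min_eq_right hc1]
  ring

theorem ciInf_lowerFun {h : T → ℝ} (hc : Continuous h) {z : T} (hz : ∀ t, t ≤ z)
    (h1 : 1 ≤ h z - ⨅ u, h u) : ⨅ u, lowerFun h u = (⨅ u, h u) - 1 := by
  have : Nonempty T := ⟨z⟩
  obtain ⟨s, -, hs⟩ := exists_lowerFun_eq hc (t := z) one_pos le_rfl (by
    have : h z ≤ ⨅ u : Set.Ici z, h u := le_futureMin fun s hs => by rw [le_antisymm hs (hz s)]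
    linarith)
  exact le_antisymm (hs ▸ ciInf_le ⟨_, by rintro _ ⟨u, rfl⟩; exact ciInf_sub_one_le_lowerFun hc u⟩ s)
    (le_ciInf (ciInf_sub_one_le_lowerFun hc))

/-- Let $d(t)$ be the future minimum of `h` at `t` minus $m$, truncated at 1. The past minimum of
`lowerFun h` at `t` is $m-d(t)$ when $d(t)>0$ and at least $m$ when $d(t)=0$, while its global
minimum is $m-1$. So `raiseFun` adds back exactly the $2d(t)$ that was subtracted. -/
theorem raiseFun_lowerFun {h : T → ℝ} (hc : Continuous h) {z : T} (hz : ∀ t, t ≤ z)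
    (h1 : 1 ≤ h z - ⨅ u, h u) : raiseFun (lowerFun h) = h := by
  have : Nonempty T := ⟨z⟩
  funext t
  have hbdd : BddBelow (Set.range fun s : Set.Iic t => lowerFun h s) :=
    ⟨_, by rintro _ ⟨u, rfl⟩; exact ciInf_sub_one_le_lowerFun hc u⟩
  have : Nonempty (Set.Iic t) := ⟨⟨t, le_rfl⟩⟩
  have hnn := ciInf_le_futureMin hc t
  unfold raiseFun
  rw [ciInf_lowerFun hc hz h1]
  rcases le_total 1 ((⨅ u : Set.Ici t, h u) - (⨅ u, h u)) with hM | hM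
  · obtain ⟨s, hst, hs⟩ := exists_lowerFun_eq hc one_pos le_rfl hM
    have hmin : ⨅ s : Set.Iic t, lowerFun h s = (⨅ u, h u) - 1 :=
      le_antisymm (hs ▸ ciInf_le hbdd (⟨s, hst⟩ : Set.Iic t))
        (le_ciInf fun s => ciInf_sub_one_le_lowerFun hc s)
    rw [hmin, sub_self, min_eq_right zero_le_one]
    unfold lowerFun
    rw [min_eq_left hM]
    ring
  · have hlow : (⨅ u, h u) - ((⨅ u : Set.Ici t, h u) - (⨅ u, h u)) ≤
        ⨅ s : Set.Iic t, lowerFun h s :=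
      le_ciInf fun s => le_lowerFun hc hM (by linarith [futureMin_mono hc s.2])
    have key : min 1 ((⨅ s : Set.Iic t, lowerFun h s) - ((⨅ u, h u) - 1)) =
        1 - ((⨅ u : Set.Ici t, h u) - (⨅ u, h u)) := by
      rcases eq_or_lt_of_le hnn with h0 | h0
      · rw [min_eq_left (by linarith)]
        linarith
      · obtain ⟨s, hst, hs⟩ := exists_lowerFun_eq hc (sub_pos.2 h0) hM le_rfl
        have := ciInf_le hbdd (⟨s, hst⟩ : Set.Iic t)
        rw [min_eq_right (by linarith)]
        linarith
    rw [key]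
    unfold lowerFun
    rw [min_eq_right hM]
    ring

/-- `raiseFun` is conjugate to `lowerFun` under reversal of time, up to a shift. -/
theorem raiseFun_eq_lowerFun_dual (h : T → ℝ) :
    raiseFun h = fun t => lowerFun (T := Tᵒᵈ) (h ∘ OrderDual.ofDual) (OrderDual.toDual t) + 2 := by
  funext t
  change h t + 2 * (1 - min 1 ((⨅ s : Set.Iic t, h s) - ⨅ s, h s)) =
    h t - 2 * min 1 ((⨅ s : Set.Iic t, h s) - ⨅ s, h s) + 2
  ring

theorem ciInf_raiseFun {h : T → ℝ} (hc : Continuous h) {z : T} (hz : ∀ t, z ≤ t)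
    (h1 : 1 ≤ h z - ⨅ u, h u) : ⨅ u, raiseFun h u = (⨅ u, h u) + 1 := by
  have : Nonempty T := ⟨z⟩
  have : CompactSpace Tᵒᵈ := ‹CompactSpace T›
  have : PreconnectedSpace Tᵒᵈ := ‹PreconnectedSpace T›
  have hcd : Continuous (h ∘ OrderDual.ofDual : Tᵒᵈ → ℝ) := hc
  rw [raiseFun_eq_lowerFun_dual]
  have := ciInf_lowerFun hcd (z := OrderDual.toDual z) hz h1
  have hb : BddBelow (Set.range fun t : T =>
      lowerFun (T := Tᵒᵈ) (h ∘ OrderDual.ofDual) (OrderDual.toDual t)) :=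
    ⟨_, by rintro _ ⟨u, rfl⟩; exact ciInf_sub_one_le_lowerFun hcd u⟩
  refine (ciInf_add hb 2).symm.trans ?_
  change (⨅ u, lowerFun (T := Tᵒᵈ) (h ∘ OrderDual.ofDual) u) + 2 = _
  rw [this]
  change (⨅ u, h u) - 1 + 2 = _
  ring

/-- This is `raiseFun_lowerFun` on the order dual; the shift by 2 cancels because only differences
of minima enter. -/
theorem lowerFun_raiseFun {h : T → ℝ} (hc : Continuous h) {z : T} (hz : ∀ t, z ≤ t)
    (h1 : 1 ≤ h z - ⨅ u, h u) : lowerFun (raiseFun h) = h := by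
  have : Nonempty T := ⟨z⟩
  have : CompactSpace Tᵒᵈ := ‹CompactSpace T›
  have : PreconnectedSpace Tᵒᵈ := ‹PreconnectedSpace T›
  have hcd : Continuous (h ∘ OrderDual.ofDual : Tᵒᵈ → ℝ) := hc
  have key := raiseFun_lowerFun hcd (z := OrderDual.toDual z) hz h1
  rw [raiseFun_eq_lowerFun_dual]
  set g : T → ℝ := fun t => lowerFun (T := Tᵒᵈ) (h ∘ OrderDual.ofDual) (OrderDual.toDual t)
    with hg
  have hlow : ∀ t, (⨅ u, h u) - 1 ≤ g t := fun t => ciInf_sub_one_le_lowerFun hcd _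
  funext t
  have kt : g t + 2 * (1 - min 1 ((⨅ s : Set.Ici t, g s) - ⨅ s, g s)) = h t :=
    congrFun key (OrderDual.toDual t)
  have : Nonempty (Set.Ici t) := ⟨⟨t, le_rfl⟩⟩
  change g t + 2 - 2 * min 1 ((⨅ s : Set.Ici t, (g s + 2)) - ⨅ s, (g s + 2)) = h t
  rw [← ciInf_add (f := g) ⟨_, by rintro _ ⟨u, rfl⟩; exact hlow u⟩,
    ← ciInf_add (f := fun s : Set.Ici t => g s) ⟨_, by rintro _ ⟨u, rfl⟩; exact hlow u⟩,
    add_sub_add_right_eq_sub]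
  linarith

end RankOneGeneral

/-! ### Strings -/

/-- A set with mutually inverse partial operators `e`, `f` whose domains are given by `1 ≤ ε` and
`1 ≤ φ`, so that it decomposes into strings. -/
structure IsStringSystem {P A : Type*} [AddCommGroup A] (B : Set P) (wt : P → A) (α : A)
    (e f : P → P) (ε φ : P → ℤ) : Prop where
  f_mem : ∀ p ∈ B, 1 ≤ φ p → f p ∈ B
  wt_f : ∀ p ∈ B, 1 ≤ φ p → wt (f p) = wt p - α
  eps_f : ∀ p ∈ B, 1 ≤ φ p → ε (f p) = ε p + 1
  phi_f : ∀ p ∈ B, 1 ≤ φ p → φ (f p) = φ p - 1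
  e_f : ∀ p ∈ B, 1 ≤ φ p → e (f p) = p
  e_mem : ∀ p ∈ B, 1 ≤ ε p → e p ∈ B
  wt_e : ∀ p ∈ B, 1 ≤ ε p → wt (e p) = wt p + α
  eps_e : ∀ p ∈ B, 1 ≤ ε p → ε (e p) = ε p - 1
  phi_e : ∀ p ∈ B, 1 ≤ ε p → φ (e p) = φ p + 1
  f_e : ∀ p ∈ B, 1 ≤ ε p → f (e p) = p
  eps_nonneg : ∀ p ∈ B, 0 ≤ ε p
  phi_nonneg : ∀ p ∈ B, 0 ≤ φ p

/-- Move `k` steps along a string, downwards if `k` is positive. -/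
def stringShift {P : Type*} (e f : P → P) (k : ℤ) (p : P) : P :=
  f^[k.toNat] (e^[(-k).toNat] p)

namespace IsStringSystem

variable {P A : Type*} [AddCommGroup A] {B : Set P} {wt : P → A} {α : A} {e f : P → P}
  {ε φ : P → ℤ}

theorem symm (S : IsStringSystem B wt α e f ε φ) : IsStringSystem B wt (-α) f e φ ε where
  f_mem := S.e_mem
  wt_f p hp h := by rw [S.wt_e p hp h, sub_neg_eq_add]
  eps_f := S.phi_e
  phi_f := S.eps_e
  e_f := S.f_e
  e_mem := S.f_mem
  wt_e p hp h := by rw [S.wt_f p hp h, sub_eq_add_neg]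
  eps_e := S.phi_f
  phi_e := S.eps_f
  f_e := S.e_f
  eps_nonneg := S.phi_nonneg
  phi_nonneg := S.eps_nonneg

theorem iterate_f (S : IsStringSystem B wt α e f ε φ) {p : P} (hp : p ∈ B) (n : ℕ)
    (hn : (n : ℤ) ≤ φ p) :
    f^[n] p ∈ B ∧ wt (f^[n] p) = wt p - n • α ∧ ε (f^[n] p) = ε p + n ∧
      φ (f^[n] p) = φ p - n ∧ e^[n] (f^[n] p) = p := by
  induction n with
  | zero => simpa using hp
  | succ n ih =>
    push_cast at hn
    obtain ⟨h1, h2, h3, h4, h5⟩ := ih (by linarith)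
    have h6 : 1 ≤ φ (f^[n] p) := by rw [h4]; linarith
    rw [Function.iterate_succ_apply' f, Function.iterate_succ_apply e, S.e_f _ h1 h6,
      S.wt_f _ h1 h6, S.eps_f _ h1 h6, S.phi_f _ h1 h6, h2, h3, h4]
    refine ⟨S.f_mem _ h1 h6, ?_, ?_, ?_, h5⟩
    · rw [succ_nsmul, sub_sub]
    · push_cast; ring
    · push_cast; ring

theorem shift (S : IsStringSystem B wt α e f ε φ) {p : P} (hp : p ∈ B) {k : ℤ}
    (hk : k ≤ φ p) (hk' : -k ≤ ε p) :
    stringShift e f k p ∈ B ∧ wt (stringShift e f k p) = wt p - k • α ∧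
      ε (stringShift e f k p) = ε p + k ∧ φ (stringShift e f k p) = φ p - k ∧
      stringShift e f (-k) (stringShift e f k p) = p := by
  unfold stringShift
  rw [neg_neg]
  obtain ⟨n, rfl | rfl⟩ := Int.eq_nat_or_neg k
  · simpa using! S.iterate_f hp n hk
  · obtain ⟨h1, h2, h3, h4, h5⟩ := S.symm.iterate_f hp n (by simpa using hk')
    simp only [Int.toNat_neg_natCast, neg_neg, Int.toNat_natCast, Function.iterate_zero, id]
    refine ⟨h1, by rw [h2]; simp, by rw [h4]; ring, by rw [h3]; ring, h5⟩

end IsStringSystem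

section PathOperators

/-! ### Continuity of paths -/

variable {ι V N : Type*} [AddCommGroup V] [Module ℝ V] [AddCommGroup N] [Module ℝ N]
variable {Φ : RootPairing ι ℝ V N}

/-- `V` carries no topology, so continuity is tested on linear functionals. Starting at 0 belongs to
the same induction: it makes the two pieces of a concatenation match at the joint. -/
theorem IsPath.regular {p : PathMap V} (hp : IsPath Φ p) :
    p.toFun ⟨0, le_rfl, p.len_nonneg⟩ = 0 ∧
      ∀ g : V →ₗ[ℝ] ℝ, Continuous fun t => g (p.toFun t) := by
  induction hp with
  | straight v hv =>
    refine ⟨zero_smul ℝ v, fun g => ?_⟩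
    simp only [PathMap.straight, map_smul, smul_eq_mul]
    fun_prop
  | concat p q _ _ hp hq =>
    refine ⟨?_, fun g => ?_⟩
    · simp only [PathMap.concat, p.len_nonneg, dite_true]
      exact hp.1
    · have hP : Continuous fun t : ℝ =>
          g (Set.IccExtend p.len_nonneg p.toFun t) :=
        (hp.2 g).comp continuous_projIcc
      have hQ : Continuous fun t : ℝ =>
          g (Set.IccExtend q.len_nonneg q.toFun t) :=
        (hq.2 g).comp continuous_projIcc
      have hcont : Continuous fun t : ℝ => if t ≤ p.len then
          g (Set.IccExtend p.len_nonneg p.toFun t) else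
          g p.wt + g (Set.IccExtend q.len_nonneg q.toFun (t - p.len)) := by
        refine Continuous.if_le hP (continuous_const.add
          (hQ.comp (continuous_id.sub continuous_const))) continuous_id continuous_const ?_
        rintro t rfl
        rw [sub_self, Set.IccExtend_right, Set.IccExtend_left, hq.1, map_zero, add_zero]
        rfl
      refine (hcont.comp continuous_subtype_val).congr fun t => ?_
      have ht := t.2
      simp only [PathMap.concat, Function.comp] at ht ⊢
      split_ifs with h
      · rw [Set.IccExtend_of_mem _ _ ⟨ht.1, h⟩]
      · rw [map_add, Set.IccExtend_of_mem _ _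
          ⟨sub_nonneg.2 (not_le.1 h).le, sub_le_iff_le_add'.2 ht.2⟩]
  | reverse p _ hp =>
    refine ⟨?_, fun g => ?_⟩
    · simp only [PathMap.reverse, sub_zero]
      exact sub_self _
    · simp only [PathMap.reverse, map_sub]
      refine ((hp.2 g).comp (Continuous.subtype_mk ?_ _)).sub continuous_const
      exact continuous_const.sub continuous_subtype_val
  | stretch r hr p _ hp =>
    refine ⟨?_, fun g => ?_⟩
    · simp only [PathMap.stretch, zero_div]
      rw [hp.1, smul_zero]
    · simp only [PathMap.stretch, map_smul, smul_eq_mul]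
      refine continuous_const.mul ((hp.2 g).comp (Continuous.subtype_mk ?_ _))
      exact continuous_subtype_val.div_const r

theorem IsPath.continuous_proj {p : PathMap V} (hp : IsPath Φ p) (i : ι) :
    Continuous (proj Φ i p) :=
  hp.regular.2 _

theorem IsPath.proj_zero {p : PathMap V} (hp : IsPath Φ p) (i : ι) :
    proj Φ i p ⟨0, le_rfl, p.len_nonneg⟩ = 0 := by
  rw [proj, hp.regular.1, map_zero]

/-! ### The root operators as total functions -/

section Operators

variable (Φ) (i : ι)

/-- The root operator `f`, without its domain of definition. -/
abbrev lowerPath (p : PathMap V) : PathMap V :=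
  { p with toFun := fun t => p.toFun t -
      ((1 / 2 : ℝ) * (proj Φ i p t - lowerFun (proj Φ i p) t)) • Φ.root i }

/-- The root operator `e`, without its domain of definition. -/
abbrev raisePath (p : PathMap V) : PathMap V :=
  { p with toFun := fun t => p.toFun t +
      ((1 / 2 : ℝ) * (raiseFun (proj Φ i p) t - proj Φ i p t)) • Φ.root i }

/-- The number of times `e` can be applied to a path. -/
def eps (p : PathMap V) : ℤ :=
  ⌊-⨅ t, proj Φ i p t⌋

/-- The number of times `f` can be applied to a path. -/
def phi (p : PathMap V) : ℤ :=
  ⌊Φ.coroot' i p.wt - ⨅ t, proj Φ i p t⌋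

theorem rootF_eq (p : PathMap V) :
    rootF Φ i p = if 1 ≤ phi Φ i p then some (lowerPath Φ i p) else none := by
  have h : 1 ≤ phi Φ i p ↔ 1 ≤ proj Φ i p ⟨p.len, p.len_nonneg, le_rfl⟩ - ⨅ t, proj Φ i p t := by
    rw [phi, Int.le_floor]
    simp [proj, PathMap.wt]
  unfold rootF rankOneF
  simp only [h]
  split_ifs <;> rfl

theorem rootE_eq {p : PathMap V} (hp : IsPath Φ p) :
    rootE Φ i p = if 1 ≤ eps Φ i p then some (raisePath Φ i p) else none := by
  have h : 1 ≤ eps Φ i p ↔ 1 ≤ proj Φ i p ⟨0, le_rfl, p.len_nonneg⟩ - ⨅ t, proj Φ i p t := by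
    rw [eps, Int.le_floor, hp.proj_zero]
    simp
  unfold rootE rankOneE
  simp only [h]
  split_ifs <;> rfl

theorem proj_lowerPath (p : PathMap V) :
    proj Φ i (lowerPath Φ i p) = lowerFun (proj Φ i p) := by
  funext t
  have h : Φ.coroot' i (Φ.root i) = 2 := Φ.root_coroot_two i
  simp only [proj, map_sub, map_smul, smul_eq_mul, h]
  ring

theorem proj_raisePath (p : PathMap V) :
    proj Φ i (raisePath Φ i p) = raiseFun (proj Φ i p) := by
  funext t
  have h : Φ.coroot' i (Φ.root i) = 2 := Φ.root_coroot_two i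
  simp only [proj, map_add, map_smul, smul_eq_mul, h]
  ring

end Operators

instance preconnectedSpace_domain (p : PathMap V) : PreconnectedSpace (Set.Icc (0 : ℝ) p.len) :=
  Subtype.preconnectedSpace isPreconnected_Icc

/-! ### The root operators decompose a crystal into strings. -/

section Strings

variable (i : ι)

theorem one_le_phi_iff {p : PathMap V} : 1 ≤ phi Φ i p ↔
    1 ≤ proj Φ i p ⟨p.len, p.len_nonneg, le_rfl⟩ - ⨅ t, proj Φ i p t := by
  rw [phi, Int.le_floor]
  simp [proj, PathMap.wt]

theorem one_le_eps_iff {p : PathMap V} (hp : IsPath Φ p) : 1 ≤ eps Φ i p ↔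
    1 ≤ proj Φ i p ⟨0, le_rfl, p.len_nonneg⟩ - ⨅ t, proj Φ i p t := by
  rw [eps, Int.le_floor, hp.proj_zero]
  simp

theorem lowerFun_right {p : PathMap V} (h : 1 ≤ phi Φ i p) :
    lowerFun (proj Φ i p) ⟨p.len, p.len_nonneg, le_rfl⟩ = Φ.coroot' i p.wt - 2 := by
  have h1 := (one_le_phi_iff i).1 h
  have h2 : proj Φ i p ⟨p.len, p.len_nonneg, le_rfl⟩ ≤
      ⨅ s : Set.Ici (⟨p.len, p.len_nonneg, le_rfl⟩ : Set.Icc (0 : ℝ) p.len), proj Φ i p s :=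
    le_futureMin fun s hs => by rw [le_antisymm hs s.2.2]
  unfold lowerFun
  rw [min_eq_left (by linarith)]
  simp [proj, PathMap.wt]

theorem raiseFun_right (p : PathMap V) :
    raiseFun (proj Φ i p) ⟨p.len, p.len_nonneg, le_rfl⟩ = Φ.coroot' i p.wt + 2 := by
  have h2 : ⨅ s : Set.Iic (⟨p.len, p.len_nonneg, le_rfl⟩ : Set.Icc (0 : ℝ) p.len), proj Φ i p s =
      ⨅ s, proj Φ i p s :=
    (Equiv.subtypeUnivEquiv fun s : Set.Icc (0 : ℝ) p.len => s.2.2).iInf_congr fun s => rfl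
  unfold raiseFun
  rw [h2, sub_self, min_eq_right zero_le_one]
  simp [proj, PathMap.wt]

theorem wt_lowerPath {p : PathMap V} (h : 1 ≤ phi Φ i p) :
    (lowerPath Φ i p).wt = p.wt - Φ.root i := by
  change p.wt - ((1 / 2 : ℝ) * (Φ.coroot' i p.wt -
    lowerFun (proj Φ i p) ⟨p.len, p.len_nonneg, le_rfl⟩)) • Φ.root i = _
  rw [lowerFun_right i h]
  norm_num

theorem wt_raisePath (p : PathMap V) :
    (raisePath Φ i p).wt = p.wt + Φ.root i := by
  change p.wt + ((1 / 2 : ℝ) * (raiseFun (proj Φ i p) ⟨p.len, p.len_nonneg, le_rfl⟩ -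
    Φ.coroot' i p.wt)) • Φ.root i = _
  rw [raiseFun_right]
  norm_num

theorem ciInf_proj_lowerPath {p : PathMap V} (hp : IsPath Φ p) (h : 1 ≤ phi Φ i p) :
    ⨅ t, proj Φ i (lowerPath Φ i p) t = (⨅ t, proj Φ i p t) - 1 := by
  rw [proj_lowerPath]
  exact ciInf_lowerFun (hp.continuous_proj i) (fun t => t.2.2) ((one_le_phi_iff i).1 h)

theorem ciInf_proj_raisePath {p : PathMap V} (hp : IsPath Φ p) (h : 1 ≤ eps Φ i p) :
    ⨅ t, proj Φ i (raisePath Φ i p) t = (⨅ t, proj Φ i p t) + 1 := by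
  rw [proj_raisePath]
  exact ciInf_raiseFun (hp.continuous_proj i) (fun t => t.2.1) ((one_le_eps_iff i hp).1 h)

theorem raisePath_lowerPath {p : PathMap V} (hp : IsPath Φ p) (h : 1 ≤ phi Φ i p) :
    raisePath Φ i (lowerPath Φ i p) = p := by
  have key := raiseFun_lowerFun (hp.continuous_proj i) (fun t => t.2.2)
    ((one_le_phi_iff i).1 h)
  unfold raisePath
  rw [proj_lowerPath, key]
  simp only [lowerPath, sub_add_cancel]

theorem lowerPath_raisePath {p : PathMap V} (hp : IsPath Φ p) (h : 1 ≤ eps Φ i p) :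
    lowerPath Φ i (raisePath Φ i p) = p := by
  have key := lowerFun_raiseFun (hp.continuous_proj i) (fun t => t.2.1)
    ((one_le_eps_iff i hp).1 h)
  unfold lowerPath
  rw [proj_raisePath, key]
  simp only [raisePath, add_sub_cancel_right]

variable {i} {b : Φ.Base} {B : Set (PathMap V)}

theorem IsCrystal.isStringSystem (hB : IsCrystal b B) (hi : i ∈ b.support) :
    IsStringSystem B PathMap.wt (Φ.root i) (raisePath Φ i) (lowerPath Φ i) (eps Φ i)
      (phi Φ i) where
  f_mem p hp h := hB.rootF_mem i hi p hp _ (by rw [rootF_eq, if_pos h])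
  wt_f p hp h := wt_lowerPath i h
  eps_f p hp h := by
    rw [eps, ciInf_proj_lowerPath i (hB.isPath p hp) h, neg_sub', sub_neg_eq_add, Int.floor_add_one]
    rfl
  phi_f p hp h := by
    rw [phi, ciInf_proj_lowerPath i (hB.isPath p hp) h, wt_lowerPath i h, map_sub,
      phi, ← Int.floor_sub_one]
    have h2 : Φ.coroot' i (Φ.root i) = 2 := Φ.root_coroot_two i
    rw [h2]
    congr 1
    ring
  e_f p hp h := raisePath_lowerPath i (hB.isPath p hp) h
  e_mem p hp h := hB.rootE_mem i hi p hp _ (by rw [rootE_eq Φ i (hB.isPath p hp), if_pos h])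
  wt_e p hp h := wt_raisePath i p
  eps_e p hp h := by
    rw [eps, ciInf_proj_raisePath i (hB.isPath p hp) h, neg_add', Int.floor_sub_one]
    rfl
  phi_e p hp h := by
    rw [phi, ciInf_proj_raisePath i (hB.isPath p hp) h, wt_raisePath i, map_add,
      phi, ← Int.floor_add_one]
    have h2 : Φ.coroot' i (Φ.root i) = 2 := Φ.root_coroot_two i
    rw [h2]
    congr 1
    ring
  f_e p hp h := lowerPath_raisePath i (hB.isPath p hp) h
  eps_nonneg p hp := by
    have h1 := ciInf_le_of_compact ((hB.isPath p hp).continuous_proj i) ⟨0, le_rfl, p.len_nonneg⟩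
    rw [(hB.isPath p hp).proj_zero] at h1
    exact Int.floor_nonneg.2 (by linarith)
  phi_nonneg p hp := by
    have h1 := ciInf_le_of_compact ((hB.isPath p hp).continuous_proj i)
      ⟨p.len, p.len_nonneg, le_rfl⟩
    exact Int.floor_nonneg.2 (sub_nonneg.2 h1)

/-- The two floors are of numbers differing by $\langle\mathrm{wt}(p),\alpha^\vee\rangle$, which can
be pulled out because it is an integer. -/
theorem phi_sub_eps {p : PathMap V} (hp : p.wt ∈ weightLattice Φ) :
    ((phi Φ i p - eps Φ i p : ℤ) : ℝ) = Φ.coroot' i p.wt := by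
  obtain ⟨k, hk⟩ := hp i
  rw [phi, eps, hk, sub_eq_add_neg (k : ℝ), Int.floor_intCast_add]
  push_cast
  ring

end Strings

end PathOperators

section Exit

/-! ### First exit from the shifted chamber -/

variable {ι V N : Type*} [AddCommGroup V] [Module ℝ V] [AddCommGroup N] [Module ℝ N]
variable {Φ : RootPairing ι ℝ V N}

/-- The value of a path at a real time, extended by `0`. -/
def PathMap.val (p : PathMap V) (s : ℝ) : V :=
  if hs : s ∈ Set.Icc 0 p.len then p.toFun ⟨s, hs⟩ else 0

/-- Two paths of the same length agree up to time `t`. -/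
def AgreeUpTo (t : ℝ) (p q : PathMap V) : Prop :=
  p.len = q.len ∧ ∀ s ≤ t, p.val s = q.val s

theorem AgreeUpTo.refl (t : ℝ) (p : PathMap V) : AgreeUpTo t p p :=
  ⟨rfl, fun _ _ => rfl⟩

theorem AgreeUpTo.symm {t : ℝ} {p q : PathMap V} (h : AgreeUpTo t p q) : AgreeUpTo t q p :=
  ⟨h.1.symm, fun s hs => (h.2 s hs).symm⟩

theorem AgreeUpTo.trans {t : ℝ} {p q r : PathMap V} (h : AgreeUpTo t p q)
    (h' : AgreeUpTo t q r) : AgreeUpTo t p r :=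
  ⟨h.1.trans h'.1, fun s hs => (h.2 s hs).trans (h'.2 s hs)⟩

variable (Φ) in
/-- The projection of `p` to the `i`-th coroot stays `≥ -1` up to time `t`, and `> -1` strictly
before. -/
def IsSafe (i : ι) (t : ℝ) (p : PathMap V) : Prop :=
  (∀ s < t, -1 < Φ.coroot' i (p.val s)) ∧ ∀ s ≤ t, -1 ≤ Φ.coroot' i (p.val s)

theorem IsSafe.congr {i : ι} {t : ℝ} {p q : PathMap V} (h : IsSafe Φ i t p)
    (hpq : AgreeUpTo t p q) : IsSafe Φ i t q :=
  ⟨fun s hs => hpq.2 s hs.le ▸ h.1 s hs, fun s hs => hpq.2 s hs ▸ h.2 s hs⟩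

theorem val_of_mem (p : PathMap V) (s : Set.Icc (0 : ℝ) p.len) : p.val s = p.toFun s := by
  rw [PathMap.val, dif_pos s.2]

theorem exists_proj_eq_ciInf {p : PathMap V} (hp : IsPath Φ p) (i : ι) :
    ∃ s, proj Φ i p s = ⨅ t, proj Φ i p t := by
  have : Nonempty (Set.Icc (0 : ℝ) p.len) := ⟨⟨0, le_rfl, p.len_nonneg⟩⟩
  exact exists_eq_ciInf_of_compact (hp.continuous_proj i)

/-- The minimum is at most $-1$ and safety prevents it from being attained before `t`. Up to `t` the
future minimum is therefore the global one, and `f` subtracts nothing. -/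
theorem agreeUpTo_lowerPath {i : ι} {t : ℝ} {p : PathMap V} (hp : IsPath Φ p)
    (hs : IsSafe Φ i t p) (h : 1 ≤ eps Φ i p) : AgreeUpTo t p (lowerPath Φ i p) := by
  refine ⟨rfl, fun s hst => ?_⟩
  unfold PathMap.val
  split_ifs with hmem
  · obtain ⟨u, hu⟩ := exists_proj_eq_ciInf hp i
    rw [eps, Int.le_floor] at h
    push_cast at h
    have htu : t ≤ u := by
      by_contra hlt
      have := hs.1 u (not_le.1 hlt)
      rw [val_of_mem] at this
      change -1 < proj Φ i p u at this
      linarith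
    have hc := hp.continuous_proj i
    have hM : ⨅ v : Set.Ici (⟨s, hmem⟩ : Set.Icc (0 : ℝ) p.len), proj Φ i p v =
        ⨅ v, proj Φ i p v :=
      le_antisymm ((futureMin_le hc (show ⟨s, hmem⟩ ≤ u from hst.trans htu)).trans hu.le)
        (ciInf_le_futureMin hc _)
    have hL : lowerFun (proj Φ i p) ⟨s, hmem⟩ = proj Φ i p ⟨s, hmem⟩ := by
      unfold lowerFun
      rw [hM, sub_self, min_eq_right zero_le_one]
      ring
    change _ = _ - ((1 / 2 : ℝ) * (_ - lowerFun (proj Φ i p) ⟨s, hmem⟩)) • _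
    rw [hL, sub_self, mul_zero, zero_smul, sub_zero]
  · rfl

/-- The past minimum up to `t` is at least $-1$ and the global one at most $-2$; the gap of 1
truncates the correction to zero. With `eps` equal to 1 this argument fails, which is why tops of
strings are set aside. -/
theorem agreeUpTo_raisePath {i : ι} {t : ℝ} {p : PathMap V}
    (hs : IsSafe Φ i t p) (h : 2 ≤ eps Φ i p) : AgreeUpTo t p (raisePath Φ i p) := by
  refine ⟨rfl, fun s hst => ?_⟩
  unfold PathMap.val
  split_ifs with hmem
  · rw [eps, Int.le_floor] at h
    push_cast at h
    have : Nonempty (Set.Iic (⟨s, hmem⟩ : Set.Icc (0 : ℝ) p.len)) := ⟨⟨_, Set.self_mem_Iic⟩⟩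
    have hM : -1 ≤ ⨅ v : Set.Iic (⟨s, hmem⟩ : Set.Icc (0 : ℝ) p.len), proj Φ i p v := by
      refine le_ciInf fun v => ?_
      have := hs.2 v ((show (v : ℝ) ≤ s from v.2).trans hst)
      rwa [val_of_mem] at this
    have hL : raiseFun (proj Φ i p) ⟨s, hmem⟩ = proj Φ i p ⟨s, hmem⟩ := by
      unfold raiseFun
      rw [min_eq_left (by linarith)]
      ring
    change _ = _ + ((1 / 2 : ℝ) * (raiseFun (proj Φ i p) ⟨s, hmem⟩ - _)) • _
    rw [hL, sub_self, mul_zero, zero_smul, add_zero]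
  · rfl

section Crystal

variable {b : Φ.Base} {B : Set (PathMap V)} {i : ι}

/-- The bound `hk'` says that the shifted path still has `eps` at least 1, so the motion never
reaches the top of the string and every single step preserves the initial part. -/
theorem IsCrystal.agreeUpTo_shift (hB : IsCrystal b B) (hi : i ∈ b.support) {p : PathMap V}
    (hp : p ∈ B) {t : ℝ} (hs : IsSafe Φ i t p) (h : 1 ≤ eps Φ i p) {k : ℤ} (hk : k ≤ phi Φ i p)
    (hk' : 1 - k ≤ eps Φ i p) :
    AgreeUpTo t p (stringShift (raisePath Φ i) (lowerPath Φ i) k p) := by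
  have S := hB.isStringSystem hi
  unfold stringShift
  obtain ⟨n, rfl | rfl⟩ := Int.eq_nat_or_neg k
  · simp only [Int.toNat_neg_natCast, Int.toNat_natCast, Function.iterate_zero, id]
    clear hk'
    induction n with
    | zero => exact AgreeUpTo.refl t p
    | succ n ih =>
      push_cast at hk
      have h1 := ih (by linarith)
      obtain ⟨h2, -, h3, -, -⟩ := S.iterate_f hp n (by linarith)
      rw [Function.iterate_succ_apply']
      exact h1.trans (agreeUpTo_lowerPath (hB.isPath _ h2) (hs.congr h1) (by rw [h3]; omega))
  · simp only [Int.toNat_neg_natCast, neg_neg, Int.toNat_natCast, Function.iterate_zero, id]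
    clear hk
    induction n with
    | zero => exact AgreeUpTo.refl t p
    | succ n ih =>
      push_cast at hk'
      have h1 := ih (by linarith)
      obtain ⟨h2, -, -, h3, -⟩ := S.symm.iterate_f hp n (by linarith)
      rw [Function.iterate_succ_apply']
      exact h1.trans (agreeUpTo_raisePath (hs.congr h1) (by rw [h3]; linarith))

/-- `p` leaves the shifted chamber for the first time at time `t`, through the `i`-th wall. -/
def IsFirstExit (b : Φ.Base) (p : PathMap V) (t : ℝ) (i : ι) : Prop :=
  i ∈ b.support ∧ Φ.coroot' i (p.val t) ≤ -1 ∧ ∀ j ∈ b.support, IsSafe Φ j t p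

/-- The walls through which `p` leaves the shifted chamber for the first time. -/
def exitWalls (b : Φ.Base) (p : PathMap V) : Set ι :=
  {i | ∃ t, IsFirstExit b p t i}

theorem IsFirstExit.congr {p q : PathMap V} {t : ℝ} (h : IsFirstExit b p t i)
    (hpq : AgreeUpTo t p q) : IsFirstExit b q t i :=
  ⟨h.1, hpq.2 t le_rfl ▸ h.2.1, fun j hj => (h.2.2 j hj).congr hpq⟩

theorem IsFirstExit.time_le {p : PathMap V} {t u : ℝ} {j : ι} (h : IsFirstExit b p t i)
    (h' : IsFirstExit b p u j) : u ≤ t := by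
  by_contra hlt
  exact absurd h.2.1 (not_le.2 ((h'.2.2 i h.1).1 t (not_le.1 hlt)))

theorem IsFirstExit.exitWalls_eq {p q : PathMap V} {t : ℝ} (h : IsFirstExit b p t i)
    (hpq : AgreeUpTo t p q) : exitWalls b p = exitWalls b q := by
  have key : ∀ {p q : PathMap V}, IsFirstExit b p t i → AgreeUpTo t p q →
      exitWalls b p ⊆ exitWalls b q := by
    -- All walls in `exitWalls` share one exit time, so agreement up to that time determines the
    -- whole set.
    rintro p q h hpq j ⟨u, hu⟩
    obtain rfl : t = u := le_antisymm (hu.time_le h) (h.time_le hu)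
    exact ⟨t, hu.congr hpq⟩
  exact (key h hpq).antisymm (key (h.congr hpq) hpq.symm)

theorem isHighestWeight_iff {p : PathMap V} (hp : IsPath Φ p) :
    IsHighestWeight b p ↔ ∀ i ∈ b.support, eps Φ i p < 1 := by
  refine forall₂_congr fun i hi => ?_
  rw [rootE_eq Φ i hp]
  split_ifs with h <;> simpa using h

theorem one_le_eps_iff_exists {p : PathMap V} (hp : IsPath Φ p) :
    1 ≤ eps Φ i p ↔ ∃ s, proj Φ i p s ≤ -1 := by
  rw [eps, Int.le_floor]
  push_cast
  constructor
  · intro h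
    obtain ⟨s, hs⟩ := exists_proj_eq_ciInf hp i
    exact ⟨s, by linarith⟩
  · rintro ⟨s, hs⟩
    have := ciInf_le_of_compact (hp.continuous_proj i) s
    linarith

theorem IsFirstExit.one_le_eps {p : PathMap V} (hp : IsPath Φ p) {t : ℝ}
    (h : IsFirstExit b p t i) : 1 ≤ eps Φ i p := by
  rw [one_le_eps_iff_exists hp]
  have h1 := h.2.1
  unfold PathMap.val at h1
  split_ifs at h1 with hs
  · exact ⟨_, h1⟩
  · rw [map_zero] at h1
    norm_num at h1

theorem exists_isFirstExit {p : PathMap V} (hp : IsPath Φ p)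
    (h : ∃ i ∈ b.support, 1 ≤ eps Φ i p) : (exitWalls b p).Nonempty := by
  obtain ⟨i, hi, hip⟩ := h
  obtain ⟨s, hs⟩ := (one_le_eps_iff_exists hp).1 hip
  have hcl : IsClosed (⋃ j ∈ b.support, {u | proj Φ j p u ≤ -1}) :=
    Set.Finite.isClosed_biUnion b.support.finite_toSet fun j _ =>
      isClosed_le (hp.continuous_proj j) continuous_const
  obtain ⟨t, ht, hmin⟩ := hcl.isCompact.exists_isLeast ⟨s, Set.mem_biUnion hi hs⟩
  simp only [Set.mem_iUnion] at ht
  obtain ⟨k, hk, hkt⟩ := ht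
  have hlt : ∀ j ∈ b.support, ∀ u : ℝ, u < t → -1 < Φ.coroot' j (p.val u) := by
    intro j hj u hu
    unfold PathMap.val
    split_ifs with hmem
    · by_contra hle
      exact absurd (hmin (Set.mem_biUnion hj (not_lt.1 hle : proj Φ j p ⟨u, hmem⟩ ≤ -1)))
        (not_le.2 hu)
    · rw [map_zero]
      norm_num
  refine ⟨k, t, hk, by rwa [val_of_mem], fun j hj => ⟨hlt j hj, fun u hu => ?_⟩⟩
  rcases lt_or_eq_of_le hu with hu | rfl
  · exact (hlt j hj u hu).le
  by_contra hneg
  rw [val_of_mem] at hneg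
  change ¬ -1 ≤ proj Φ j p t at hneg
  -- A value below $-1$ at the exit time would, by the intermediate value theorem from $p_j(0)=0$,
  -- force the value $-1$ at an earlier time or at `t` itself.
  have hcont : ContinuousOn (fun u => proj Φ j p (Set.projIcc 0 p.len p.len_nonneg u))
      (Set.Icc 0 t) := ((hp.continuous_proj j).comp continuous_projIcc).continuousOn
  have h0 : proj Φ j p (Set.projIcc 0 p.len p.len_nonneg 0) = 0 := by
    rw [Set.projIcc_left]
    exact hp.proj_zero j
  have hend : proj Φ j p (Set.projIcc 0 p.len p.len_nonneg t) = proj Φ j p t := by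
    rw [Set.projIcc_val]
  obtain ⟨u, hu, hu1⟩ := intermediate_value_Icc' t.2.1 hcont
    (show (-1 : ℝ) ∈ _ from ⟨by linarith, by linarith⟩)
  have hmem : u ∈ Set.Icc 0 p.len := ⟨hu.1, hu.2.trans t.2.2⟩
  simp only at hu1
  rw [Set.projIcc_of_mem _ hmem] at hu1
  rcases lt_or_eq_of_le hu.2 with hut | rfl
  · have := hlt j hj u hut
    rw [PathMap.val, dif_pos hmem] at this
    exact this.ne' hu1
  · exact hneg hu1.ge

end Crystal

/-! ### The reflection of a crystal along strings, and its dot version -/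

section Reflections

variable {b : Φ.Base} {B : Set (PathMap V)} {i : ι}

variable (Φ) in
/-- The reflection of strings. -/
def stringReflection (i : ι) (p : PathMap V) : PathMap V :=
  stringShift (raisePath Φ i) (lowerPath Φ i) (phi Φ i p - eps Φ i p) p

variable (Φ) in
/-- The reflection of strings deprived of their top elements. -/
def dotReflection (i : ι) (p : PathMap V) : PathMap V :=
  stringShift (raisePath Φ i) (lowerPath Φ i) (phi Φ i p - eps Φ i p + 1) p

theorem IsCrystal.stringReflection_spec (hB : IsCrystal b B) (hi : i ∈ b.support) {p : PathMap V}
    (hp : p ∈ B) (hwt : p.wt ∈ weightLattice Φ) :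
    stringReflection Φ i p ∈ B ∧ (stringReflection Φ i p).wt = Φ.reflection i p.wt ∧
      stringReflection Φ i (stringReflection Φ i p) = p := by
  have S := hB.isStringSystem hi
  obtain ⟨h1, h2, h3, h4, h5⟩ := S.shift hp (k := phi Φ i p - eps Φ i p)
    (by linarith [S.eps_nonneg p hp]) (by linarith [S.phi_nonneg p hp])
  refine ⟨h1, ?_, ?_⟩
  · rw [stringReflection, h2, ← Int.cast_smul_eq_zsmul ℝ, phi_sub_eps hwt]
    rfl
  · rw [stringReflection, stringReflection, h3, h4]
    convert h5 using 2
    ring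

/-- The shift sends $(\varepsilon,\varphi)$ to $(\varphi+1,\varepsilon-1)$, an involution on
$\varepsilon\ge1$. As $s_i\rho=\rho-\alpha_i$, its effect on weights is the dot action of $s_i$. -/
theorem IsCrystal.dotReflection_spec (hB : IsCrystal b B) (hi : i ∈ b.support) {p : PathMap V}
    (hp : p ∈ B) (hwt : p.wt ∈ weightLattice Φ) (h : 1 ≤ eps Φ i p) :
    dotReflection Φ i p ∈ B ∧ (dotReflection Φ i p).wt = Φ.reflection i p.wt - Φ.root i ∧
      dotReflection Φ i (dotReflection Φ i p) = p := by
  have S := hB.isStringSystem hi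
  obtain ⟨h1, h2, h3, h4, h5⟩ := S.shift hp (k := phi Φ i p - eps Φ i p + 1)
    (by linarith) (by linarith [S.phi_nonneg p hp])
  refine ⟨h1, ?_, ?_⟩
  · rw [dotReflection, h2, add_smul, one_smul, ← Int.cast_smul_eq_zsmul ℝ, phi_sub_eps hwt,
      ← sub_sub]
    rfl
  · rw [dotReflection, dotReflection, h3, h4]
    convert h5 using 2
    ring

theorem IsCrystal.agreeUpTo_dotReflection (hB : IsCrystal b B) {p : PathMap V}
    (hp : p ∈ B) {t : ℝ} (h : IsFirstExit b p t i) : AgreeUpTo t p (dotReflection Φ i p) := by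
  have h1 := h.one_le_eps (hB.isPath p hp)
  exact hB.agreeUpTo_shift h.1 hp (h.2.2 i h.1) h1 (by linarith)
    (by linarith [(hB.isStringSystem h.1).phi_nonneg p hp])

/-- A sign reversing involution on the paths that leave the shifted chamber. -/
def cancel (b : Φ.Base) (p : PathMap V) : PathMap V :=
  if h : (exitWalls b p).Nonempty then dotReflection Φ h.some p else p

theorem IsCrystal.cancel_spec (hB : IsCrystal b B) {p : PathMap V}
    (hp : p ∈ B) (hwt : p.wt ∈ weightLattice Φ) (h : (exitWalls b p).Nonempty) :
    cancel b p ∈ B ∧ (∃ i ∈ b.support, (cancel b p).wt = Φ.reflection i p.wt - Φ.root i) ∧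
      (exitWalls b (cancel b p)).Nonempty ∧ cancel b (cancel b p) = p := by
  obtain ⟨t, ht⟩ := h.some_mem
  obtain ⟨h1, h2, h3⟩ := hB.dotReflection_spec ht.1 hp hwt (ht.one_le_eps (hB.isPath p hp))
  have hw := ht.exitWalls_eq (hB.agreeUpTo_dotReflection hp ht)
  have hc : cancel b p = dotReflection Φ h.some p := dif_pos h
  rw [hc]
  have h' := hw ▸ h
  refine ⟨h1, ⟨_, ht.1, h2⟩, h', ?_⟩
  rw [cancel, dif_pos h']
  -- The choice of wall depends only on the set `exitWalls`, which is unchanged, so the second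
  -- application uses the same wall.
  simp only [← hw]
  exact h3

end Reflections

end Exit

/-! ### The Weyl group -/

section WeylGroup

open RootPairing

variable {ι V N : Type*} [Finite ι] [AddCommGroup V] [Module ℝ V] [AddCommGroup N] [Module ℝ N]
variable {Φ : RootPairing ι ℝ V N} [Φ.IsRootSystem] [Φ.IsCrystallographic] [Φ.IsReduced]
variable (b : Φ.Base)

theorem ofIdx_reflectionPerm (i j : ι) :
    weylGroup.ofIdx Φ (Φ.reflectionPerm j i) =
      weylGroup.ofIdx Φ j * weylGroup.ofIdx Φ i * weylGroup.ofIdx Φ j := by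
  apply Subtype.ext
  apply RootPairing.Equiv.weightHom_injective Φ
  refine LinearEquiv.ext fun x => ?_
  change Φ.reflection (Φ.reflectionPerm j i) x = Φ.reflection j (Φ.reflection i (Φ.reflection j x))
  rw [Φ.reflection_reflectionPerm]
  rfl

/-- The Weyl group is generated by the simple reflections. -/
theorem weylGroup_induction_simple {pred : Φ.weylGroup → Prop} (one : pred 1)
    (simple : ∀ i ∈ b.support, pred (weylGroup.ofIdx Φ i))
    (mul : ∀ u v, pred u → pred v → pred (u * v)) (w : Φ.weylGroup) : pred w := by
  have hrefl : ∀ i, pred (weylGroup.ofIdx Φ i) := fun i => by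
    refine b.induction_reflect i (p := fun i => pred (weylGroup.ofIdx Φ i)) ?_ simple ?_
    · intro i hi
      rw [ofIdx_reflectionPerm]
      exact mul _ _ (mul _ _ hi hi) hi
    · intro i j hi hj
      rw [ofIdx_reflectionPerm]
      exact mul _ _ (mul _ _ (simple j hj) hi) (simple j hj)
  obtain ⟨w, hw⟩ := w
  induction hw using weylGroup.induction with
  | mem i => exact hrefl i
  | one => exact one
  | mul x y hx hy hx' hy' => exact mul ⟨x, hx⟩ ⟨y, hy⟩ hx' hy'

theorem weylDet_mul (u v : Φ.weylGroup) : weylDet Φ (u * v) = weylDet Φ u * weylDet Φ v := by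
  have h : (weylDet Φ (u * v) : ℝ) = weylDet Φ u * weylDet Φ v := by
    simp only [weylDet_cast, Subgroup.coe_mul, map_mul, LinearEquiv.coe_toLinearMap_mul]
  exact_mod_cast h

theorem weylDet_one : weylDet Φ 1 = 1 := by
  have h : (weylDet Φ 1 : ℝ) = 1 := by
    rw [weylDet_cast]
    simp only [Subgroup.coe_one, map_one]
    exact LinearMap.det_id
  exact_mod_cast h

include b in
theorem weylDet_ofIdx (i : ι) : weylDet Φ (weylGroup.ofIdx Φ i) = -1 := by
  have : Module.Finite ℝ V := Module.Finite.of_basis b.toWeightBasis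
  have h : (weylDet Φ (weylGroup.ofIdx Φ i) : ℝ) = -1 := by
    rw [weylDet_cast]
    have h2 : Φ.coroot' i (Φ.root i) = 2 := Φ.root_coroot_two i
    have : (RootPairing.Equiv.weightHom Φ (weylGroup.ofIdx Φ i : Φ.Aut) : V →ₗ[ℝ] V) =
        LinearMap.transvection (Φ.coroot' i) (-Φ.root i) := by
      ext x
      change Φ.reflection i x = _
      rw [Φ.reflection_apply, LinearMap.transvection.apply, smul_neg, sub_eq_add_neg]
    rw [this, LinearMap.transvection.det, map_neg, h2]
    norm_num
  exact_mod_cast h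

theorem weylAct_mul (u v : Φ.weylGroup) (μ : weightLattice Φ) :
    weylAct Φ (u * v) μ = weylAct Φ u (weylAct Φ v μ) :=
  Subtype.ext (mul_smul u v (μ : V))

theorem weylAct_one (μ : weightLattice Φ) : weylAct Φ 1 μ = μ :=
  Subtype.ext (one_smul _ (μ : V))

theorem weylAct_add (w : Φ.weylGroup) (μ ν : weightLattice Φ) :
    weylAct Φ w (μ + ν) = weylAct Φ w μ + weylAct Φ w ν :=
  Subtype.ext (smul_add w (μ : V) (ν : V))

theorem coe_weylAct_ofIdx (i : ι) (μ : weightLattice Φ) :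
    (weylAct Φ (weylGroup.ofIdx Φ i) μ : V) = Φ.reflection i μ :=
  rfl

theorem coroot_rho {i : ι} (hi : i ∈ b.support) : Φ.coroot' i (rho b : V) = 1 := by
  have h : (rho b : V) = ∑ j : b.support, fundamentalWeight b j := by
    simp [rho]
  rw [h, map_sum]
  simp only [coroot_fundamentalWeight b _ ⟨i, hi⟩]
  simp

theorem reflection_rho {i : ι} (hi : i ∈ b.support) :
    Φ.reflection i (rho b : V) = rho b - Φ.root i := by
  rw [Φ.reflection_apply, coroot_rho b hi, one_smul]

/-- Up to sign a coroot is a sum of simple coroots, on each of which $\rho$ takes the value 1. The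
alternative in `key` covers the empty sum. -/
theorem coroot_rho_ne_zero (i : ι) : Φ.coroot' i (rho b : V) ≠ 0 := by
  have key : ∀ y ∈ AddSubmonoid.closure (Φ.coroot '' b.support),
      y = 0 ∨ 1 ≤ Φ.toLinearMap (rho b : V) y := by
    intro y hy
    induction hy using AddSubmonoid.closure_induction with
    | mem y hy =>
      obtain ⟨j, hj, rfl⟩ := hy
      exact Or.inr (coroot_rho b hj).ge
    | zero => exact Or.inl rfl
    | add y z _ _ hy hz =>
      rcases hy with rfl | hy
      · simpa using hz
      rcases hz with rfl | hz
      · simpa using Or.inr hy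
      · right
        rw [map_add]
        linarith
  have hne : Φ.coroot i ≠ 0 := fun h => by
    have h2 : Φ.toLinearMap (Φ.root i) (Φ.coroot i) = 2 := Φ.root_coroot_two i
    rw [h, map_zero] at h2
    norm_num at h2
  change Φ.toLinearMap (rho b : V) (Φ.coroot i) ≠ 0
  rcases b.coroot_mem_or_neg_mem i with h | h
  · rcases key _ h with h | h
    · exact absurd h hne
    · linarith
  · rcases key _ h with h | h
    · exact absurd (neg_eq_zero.1 h) hne
    · rw [map_neg] at h
      linarith

/-- The product of the positive coroots. -/
def corootProd (x : V) : ℝ :=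
  letI := Fintype.ofFinite ι
  ∏ i with b.IsPos i, Φ.coroot' i x

/-- A simple reflection negates its own coroot and permutes the other positive ones; reducedness
enters here. -/
theorem corootProd_reflection {i : ι} (hi : i ∈ b.support) (x : V) :
    corootProd b (Φ.reflection i x) = -corootProd b x := by
  let := Fintype.ofFinite ι
  have hcomp : ∀ j, Φ.coroot' j (Φ.reflection i x) = Φ.coroot' (Φ.reflectionPerm i j) x :=
    fun j => by rw [Φ.coroot'_reflectionPerm]; rfl
  have hmem : i ∈ Finset.univ.filter fun j => b.IsPos j := by
    simpa using b.isPos_of_mem_support hi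
  have hneg : ¬ b.IsPos (Φ.reflectionPerm i i) := fun h =>
    (Base.IsPos.neg_iff_not b i).1 h (b.isPos_of_mem_support hi)
  have hstep : ∀ j, b.IsPos j → j ≠ i →
      b.IsPos (Φ.reflectionPerm i j) ∧ Φ.reflectionPerm i j ≠ i := by
    intro j hj hji
    refine ⟨hj.reflectionPerm hi hji, fun h => hneg ?_⟩
    have h' := congrArg (Φ.reflectionPerm i) h
    rw [Φ.reflectionPerm_self] at h'
    exact h' ▸ hj
  unfold corootProd
  rw [← Finset.mul_prod_erase _ _ hmem, ← Finset.mul_prod_erase _ _ hmem, ← neg_mul]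
  congr 1
  · rw [Φ.reflection_apply, map_sub, map_smul]
    have h2 : Φ.coroot' i (Φ.root i) = 2 := Φ.root_coroot_two i
    rw [h2, smul_eq_mul]
    ring
  · refine Finset.prod_equiv (Φ.reflectionPerm i) (fun j => ?_) fun j _ => hcomp j
    simp only [Finset.mem_erase, Finset.mem_filter, Finset.mem_univ, true_and]
    constructor
    · rintro ⟨h1, h2⟩
      exact (hstep j h2 h1).symm
    · rintro ⟨h1, h2⟩
      have := hstep _ h2 h1
      rw [Φ.reflectionPerm_self] at this
      exact this.symm

theorem corootProd_smul (w : Φ.weylGroup) (x : V) :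
    corootProd b (w • x) = weylDet Φ w * corootProd b x := by
  induction w using weylGroup_induction_simple b generalizing x with
  | one => rw [one_smul, weylDet_one, Int.cast_one, one_mul]
  | simple i hi =>
    rw [weylDet_ofIdx b]
    push_cast
    rw [neg_one_mul]
    exact corootProd_reflection b hi x
  | mul u v hu hv =>
    rw [mul_smul, hu, hv, weylDet_mul]
    push_cast
    ring

theorem weylDet_eq_one_of_fix {w : Φ.weylGroup} (h : weylAct Φ w (rho b) = rho b) :
    weylDet Φ w = 1 := by
  have h1 := corootProd_smul b w (rho b : V)
  have h2 : w • (rho b : V) = rho b := congrArg Subtype.val h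
  have h3 : corootProd b (rho b : V) ≠ 0 :=
    Finset.prod_ne_zero_iff.2 fun i _ => coroot_rho_ne_zero b i
  rw [h2] at h1
  have h4 : (weylDet Φ w : ℝ) = 1 := mul_right_cancel₀ h3 (by rw [← h1, one_mul])
  exact_mod_cast h4

/-! ### Alternants -/

theorem X_add (μ ν : weightLattice Φ) : X (μ + ν) = X μ * X ν := by
  rw [X, X, X, AddMonoidAlgebra.single_mul_single, one_mul]

/-- The coefficient of $X^\rho$ counts the stabilizer of $\rho$: an element fixing $\rho$ has
determinant 1, since `corootProd` is anti-invariant and nonzero at $\rho$. Triviality of the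
stabilizer is not needed. -/
theorem alternant_rho_ne_zero : alternant (rho b) ≠ 0 := by
  intro h
  have h1 := congrArg (fun x : GroupAlg Φ => x.coeff (rho b)) h
  have h2 : (alternant (rho b)).coeff (rho b) =
      ∑ w : Φ.weylGroup, if weylAct Φ w (rho b) = rho b then (1 : ℤ) else 0 := by
    rw [alternant, AddMonoidAlgebra.coeff_sum, Finsupp.finsetSum_apply]
    refine Finset.sum_congr rfl fun w _ => ?_
    rw [AddMonoidAlgebra.coeff_smul, Finsupp.smul_apply, X,
      AddMonoidAlgebra.coeff_single, Finsupp.single_apply]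
    split_ifs with hw
    · rw [weylDet_eq_one_of_fix b hw, one_smul]
    · rw [smul_zero]
  have h3 : (0 : ℤ) < ∑ w : Φ.weylGroup, if weylAct Φ w (rho b) = rho b then (1 : ℤ) else 0 :=
    Finset.sum_pos' (fun w _ => by split_ifs <;> norm_num)
      ⟨1, Finset.mem_univ _, by rw [if_pos (weylAct_one _)]; norm_num⟩
  rw [← h2] at h3
  exact h3.ne' h1

include b in
theorem alternant_reflection (i : ι) (μ : weightLattice Φ) :
    alternant (weylAct Φ (weylGroup.ofIdx Φ i) μ) = -alternant μ := by
  unfold alternant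
  rw [← Finset.sum_neg_distrib]
  refine Fintype.sum_equiv (_root_.Equiv.mulRight (weylGroup.ofIdx Φ i)) _ _ fun w => ?_
  rw [_root_.Equiv.coe_mulRight, weylAct_mul, weylDet_mul, weylDet_ofIdx b, mul_neg_one, neg_smul,
    neg_neg]

/-- The product of `a_μ` with an invariant sum is a sum of alternants. -/
theorem alternant_mul_sum {κ : Type*} [Fintype κ] (c : κ → weightLattice Φ)
    (hc : ∀ w, ∑ k, X (weylAct Φ w (c k)) = ∑ k, X (c k)) (μ : weightLattice Φ) :
    alternant μ * ∑ k, X (c k) = ∑ k, alternant (c k + μ) := by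
  unfold alternant
  rw [Finset.sum_comm, Finset.sum_mul]
  refine Finset.sum_congr rfl fun w _ => ?_
  -- The invariant sum is replaced by its own `w`-translate separately in each term, so that the
  -- exponents combine to $w(c_k+\mu)$.
  rw [← hc w, Finset.mul_sum]
  refine Finset.sum_congr rfl fun k _ => ?_
  rw [weylAct_add, X_add, smul_mul_assoc, mul_comm]

end WeylGroup

/-! ### Characters of crystals -/

section CrystalCharacter

open RootPairing

variable {ι V N : Type*} [Finite ι] [AddCommGroup V] [Module ℝ V] [AddCommGroup N] [Module ℝ N]
variable {Φ : RootPairing ι ℝ V N} [Φ.IsRootSystem] [Φ.IsCrystallographic] [Φ.IsReduced]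
variable {b : Φ.Base} {B : Finset (PathMap V)}

theorem IsCrystal.map_weylAct (hB : IsCrystal b (B : Set (PathMap V)))
    (hwt : ∀ p ∈ B, p.wt ∈ weightLattice Φ) (w : Φ.weylGroup) :
    (Finset.univ.val.map fun p : B => weylAct Φ w ⟨p.1.wt, hwt p.1 p.2⟩) =
      Finset.univ.val.map fun p : B => (⟨p.1.wt, hwt p.1 p.2⟩ : weightLattice Φ) := by
  induction w using weylGroup_induction_simple b with
  | one => simp only [weylAct_one]
  | simple i hi =>
    have spec := fun p : B => hB.stringReflection_spec hi p.2 (hwt p.1 p.2)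
    let σ : B → B := fun p => ⟨stringReflection Φ i p, (spec p).1⟩
    have hσ : Function.Involutive σ := fun p => Subtype.ext (spec p).2.2
    -- Reindexing by the string reflection, which realizes $s_i$ on weights.
    conv_rhs => rw [← Multiset.map_univ_val_equiv hσ.toPerm, Multiset.map_map]
    refine Multiset.map_congr rfl fun p _ => Subtype.ext ?_
    exact (spec p).2.1.symm
  | mul u v hu hv =>
    have h := congrArg (Multiset.map (weylAct Φ u)) hv
    simp only [Multiset.map_map, Function.comp_def] at h
    simp only [weylAct_mul]
    exact h.trans hu

theorem IsCrystal.sum_X_weylAct (hB : IsCrystal b (B : Set (PathMap V)))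
    (hwt : ∀ p ∈ B, p.wt ∈ weightLattice Φ) (w : Φ.weylGroup) :
    ∑ p : B, X (weylAct Φ w ⟨p.1.wt, hwt p.1 p.2⟩) = char B hwt := by
  have h := congrArg (fun s => (Multiset.map X s).sum) (hB.map_weylAct hwt w)
  simp only [Multiset.map_map] at h
  exact h

theorem range_subset_shiftedChamber_iff {p : PathMap V} (hp : IsPath Φ p) :
    Set.range p.toFun ⊆ shiftedChamber b ↔ ∀ i ∈ b.support, eps Φ i p < 1 := by
  have hmem : ∀ x, x ∈ shiftedChamber b ↔ ∀ i ∈ b.support, -1 < Φ.coroot' i x := by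
    intro x
    constructor
    · rintro ⟨y, hy, rfl⟩ i hi
      rw [map_sub, coroot_rho b hi]
      linarith [hy i hi]
    · intro h
      refine ⟨x + rho b, fun i hi => ?_, add_sub_cancel_right _ _⟩
      rw [map_add, coroot_rho b hi]
      linarith [h i hi]
  simp only [← not_le, one_le_eps_iff_exists hp, not_exists]
  constructor
  · intro h i hi s
    exact not_le.2 ((hmem _).1 (h ⟨s, rfl⟩) i hi)
  · rintro h _ ⟨s, rfl⟩
    exact (hmem _).2 fun i hi => not_le.1 (h i hi s)

theorem exitWalls_nonempty_iff {p : PathMap V} (hp : IsPath Φ p) :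
    (exitWalls b p).Nonempty ↔ ¬ Set.range p.toFun ⊆ shiftedChamber b := by
  rw [range_subset_shiftedChamber_iff hp]
  push Not
  constructor
  · rintro ⟨i, t, ht⟩
    exact ⟨i, ht.1, ht.one_le_eps hp⟩
  · exact exists_isFirstExit hp

theorem IsCrystal.sum_alternant_eq_zero (hB : IsCrystal b (B : Set (PathMap V)))
    (hwt : ∀ p ∈ B, p.wt ∈ weightLattice Φ) :
    ∑ p : B with ¬ Set.range p.1.toFun ⊆ shiftedChamber b,
      alternant (⟨p.1.wt, hwt p.1 p.2⟩ + rho b) = 0 := by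
  have hne : ∀ p : B, p ∈ Finset.univ.filter
      (fun p : B => ¬ Set.range p.1.toFun ⊆ shiftedChamber b) → (exitWalls b p.1).Nonempty :=
    fun p hp => (exitWalls_nonempty_iff (hB.isPath _ p.2)).2 (Finset.mem_filter.1 hp).2
  have spec := fun (p : B) hp => hB.cancel_spec p.2 (hwt p.1 p.2) (hne p hp)
  have hsign : ∀ (p : B) hp, alternant (⟨(cancel b p.1).wt, hwt _ (spec p hp).1⟩ + rho b) =
      -alternant (⟨p.1.wt, hwt p.1 p.2⟩ + rho b) := by
    intro p hp
    obtain ⟨i, hi, h⟩ := (spec p hp).2.1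
    rw [← alternant_reflection b i]
    congr 1
    apply Subtype.ext
    rw [coe_weylAct_ofIdx]
    push_cast
    rw [h, map_add, reflection_rho b hi]
    abel
  refine Finset.sum_involution (fun p hp => ⟨cancel b p.1, (spec p hp).1⟩) ?_ ?_ ?_ ?_
  · intro p hp
    rw [hsign p hp, add_neg_cancel]
  · intro p hp h0 heq
    have h1 := hsign p hp
    have h2 : cancel b p.1 = p.1 := congrArg Subtype.val heq
    simp only [h2] at h1
    -- A fixed path would have an alternant equal to its negative, hence zero, because the
    -- coefficients are integers.
    refine h0 (AddMonoidAlgebra.ext (Finsupp.ext fun μ => ?_))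
    have h3 := congrArg (fun x : GroupAlg Φ => x.coeff μ) h1
    simp only [AddMonoidAlgebra.coeff_neg, Finsupp.neg_apply] at h3
    simp only [AddMonoidAlgebra.coeff_zero, Finsupp.zero_apply]
    omega
  · intro p hp
    exact Finset.mem_filter.2 ⟨Finset.mem_univ _,
      (exitWalls_nonempty_iff (hB.isPath _ (spec p hp).1)).1 (spec p hp).2.2.1⟩
  · intro p hp
    exact Subtype.ext (spec p hp).2.2.2

end CrystalCharacter

end PathModel
end

theorem theorem5p5 {ι V N : Type*} [Finite ι]
    [AddCommGroup V] [Module ℝ V] [AddCommGroup N] [Module ℝ N]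
    (Φ : RootPairing ι ℝ V N) [Φ.IsRootSystem] [Φ.IsCrystallographic] [Φ.IsReduced]
    (b : Φ.Base) (B : Finset (PathModel.PathMap V))
    (hB : PathModel.IsCrystal b (B : Set (PathModel.PathMap V)))
    (hwt : ∀ p ∈ B, p.wt ∈ PathModel.weightLattice Φ) :
    (∀ p ∈ B, PathModel.IsHighestWeight b p ↔
      Set.range p.toFun ⊆ PathModel.shiftedChamber b) ∧
    algebraMap (PathModel.GroupAlg Φ) (FractionRing (PathModel.GroupAlg Φ))
        (PathModel.char B hwt) =
      ∑ p : B with Set.range p.1.toFun ⊆ PathModel.shiftedChamber b,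
        PathModel.weylChar b ⟨p.1.wt, hwt p.1 p.2⟩ := by
  refine ⟨fun p hp => ?_, ?_⟩
  · rw [PathModel.isHighestWeight_iff (hB.isPath p hp),
      PathModel.range_subset_shiftedChamber_iff (hB.isPath p hp)]
  · have h0 : algebraMap (PathModel.GroupAlg Φ) (FractionRing (PathModel.GroupAlg Φ))
        (PathModel.alternant (PathModel.rho b)) ≠ 0 :=
      fun h => PathModel.alternant_rho_ne_zero b
        (IsFractionRing.injective (PathModel.GroupAlg Φ) (FractionRing (PathModel.GroupAlg Φ))
          (h.trans (map_zero _).symm))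
    have hmul := PathModel.alternant_mul_sum
      (fun p : B => (⟨p.1.wt, hwt p.1 p.2⟩ : PathModel.weightLattice Φ))
      (hB.sum_X_weylAct hwt) (PathModel.rho b)
    have hsplit := Finset.sum_filter_add_sum_filter_not Finset.univ
      (fun p : B => Set.range p.1.toFun ⊆ PathModel.shiftedChamber b)
      (fun p : B => PathModel.alternant
        ((⟨p.1.wt, hwt p.1 p.2⟩ : PathModel.weightLattice Φ) + PathModel.rho b))
    rw [hB.sum_alternant_eq_zero hwt, add_zero] at hsplit
    rw [← hsplit] at hmul
    simp only [PathModel.weylChar]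
    rw [← Finset.sum_div, eq_div_iff h0, ← map_sum, ← hmul, map_mul, mul_comm]
    rfl
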